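/- A structured matrix $\bar A\in\{0,*\}^{n\times n}$ is a matrix each of whose entries is either a fixed zero or a free parameter $*$, the parameters being independent; let $n_{\bar A}$ be the number of its $*$ entries. A realization $A\in\mathbb R^{n\times n}$ of $\bar A$ is obtained by assigning real values to the $*$ entries, so realizations correspond to points of $\mathbb R^{n_{\bar A}}$. The generic rank $\operatorname{grank}\bar A$ is the maximum rank of a realization of $\bar A$. Call $\bar A$ generically diagonalizable if there is a proper algebraic variety $\mathbb V\subsetneq\mathbb R^{n_{\bar A}}$ (the set of real solutions of a system of polynomial equations, not the whole space) such that every realization $A\in\mathbb R^{n_{\bar A}}\setminus\mathbb V$ is diagonalizable over $\mathbb C$. Let $X=\{x_1,\dots,x_n\}$ and $E=\{(x_i,x_j):\bar A_{ji}\neq 0\}$. Let $\mathcal G(\bar A)=(X,E)$ be the associated digraph (self-loops allowed; a self-loop is a cycle, and a cycle repeats no vertex), and let $v(\bar A)$ be the maximum number of vertices covered by a collection of vertex-disjoint cycles in $\mathcal G(\bar A)$. Let $\mathcal B(\bar A)$ be the bipartite graph with left part a copy of $X$ (the rows), right part another copy of $X$ (the columns), and edge set $E$, an edge $(x_i,x_j)$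 joining the right vertex $x_i$ to the left vertex $x_j$. A matching is a set of edges no two of which share an end vertex in $\mathcal B(\bar A)$, and a maximum matching is one of largest size. Theorem. For every structured matrix $\bar A\in\{0,*\}^{n\times n}$ the following are equivalent: (a) $\bar A$ is generically diagonalizable. (b) $\operatorname{grank}\bar A=v(\bar A)$. (c) There is a maximum matching $\mathcal M$ of $\mathcal B(\bar A)$ such that the digraph $(X,\mathcal M)$ with vertex set $X$ and edge set $\mathcal M$ is a union of vertex-disjoint cycles and isolated vertices. -/

import Mathlib

/-- An entry of a structured matrix: a fixed zero, or a free parameter `*`. -/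
inductive StructEntry : Type
  | zero : StructEntry
  | star : StructEntry

/-- The set `{0,*}^{n₁ × n₂}` of structured matrices. -/
abbrev StructuredMatrix (n₁ n₂ : ℕ) : Type := Matrix (Fin n₁) (Fin n₂) StructEntry

namespace StructuredMatrix

variable {n₁ n₂ n : ℕ}

/-- The positions of the `*` entries; its cardinality is the number of free parameters. -/
abbrev FreeEntry (M : StructuredMatrix n₁ n₂) : Type :=
  {p : Fin n₁ × Fin n₂ // M p.1 p.2 = StructEntry.star}

/-- The parameter space: one real value for every `*` entry, chosen independently. -/
abbrev ParamSpace (M : StructuredMatrix n₁ n₂) : Type := FreeEntry M → ℝ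

open Classical in
/-- The realization of `M` for the parameter vector `θ`. -/
noncomputable def realization (M : StructuredMatrix n₁ n₂) (θ : ParamSpace M) :
    Matrix (Fin n₁) (Fin n₂) ℝ :=
  Matrix.of fun i j => if h : M i j = StructEntry.star then θ ⟨(i, j), h⟩ else 0

/-- The generic rank: the maximum rank over all realizations. -/
noncomputable def grank (M : StructuredMatrix n₁ n₂) : ℕ :=
  sSup (Set.range fun θ : ParamSpace M => (M.realization θ).rank)

/-- The supremum in the definition of the generic rank is a maximum. -/
theorem isGreatest_grank (M : StructuredMatrix n₁ n₂) :
    IsGreatest (Set.range fun θ : ParamSpace M => (M.realization θ).rank) (grank M) := by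
  have hne : (Set.range fun θ : ParamSpace M => (M.realization θ).rank).Nonempty :=
    ⟨_, ⟨fun _ => 0, rfl⟩⟩
  have hb : BddAbove (Set.range fun θ : ParamSpace M => (M.realization θ).rank) := by
    refine ⟨n₁, ?_⟩
    rintro _ ⟨θ, rfl⟩
    exact Matrix.rank_le_height _
  exact ⟨Nat.sSup_mem hne hb, fun _ hk => le_csSup hb hk⟩

end StructuredMatrix

/-- An algebraic variety in `ℝ^σ`: the real solution set of a system of polynomial equations. -/
def IsRealVariety {σ : Type} (V : Set (σ → ℝ)) : Prop :=
  ∃ S : Set (MvPolynomial σ ℝ), V = {θ | ∀ p ∈ S, MvPolynomial.eval θ p = 0}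

/-- A proper variety: an algebraic variety that is not the entire space. -/
def IsProperRealVariety {σ : Type} (V : Set (σ → ℝ)) : Prop :=
  IsRealVariety V ∧ V ≠ Set.univ

/-- A real square matrix is diagonalizable if it is similar, over the complex numbers, to a
diagonal matrix (its eigenvalues may be non-real). -/
def IsDiagonalizableOverComplex {n : ℕ} (A : Matrix (Fin n) (Fin n) ℝ) : Prop :=
  ∃ (P : Matrix (Fin n) (Fin n) ℂ) (d : Fin n → ℂ),
    IsUnit P ∧ A.map Complex.ofReal = P * Matrix.diagonal d * P⁻¹

/-- Almost all realizations, i.e. all outside some proper variety of the parameter space, are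
diagonalizable. -/
def StructuredMatrix.GenericallyDiagonalizable {n : ℕ} (A : StructuredMatrix n n) : Prop :=
  ∃ V : Set (A.ParamSpace), IsProperRealVariety V ∧
    ∀ θ : A.ParamSpace, θ ∉ V → IsDiagonalizableOverComplex (A.realization θ)

namespace Digraph

variable {V : Type} [DecidableEq V]

/-- A (simple, directed) cycle of a digraph: a nonempty cyclic sequence of distinct vertices, each
joined by an edge to the next one. A cyclic sequence of length one is a self-loop. -/
def IsDirectedCycle (G : Digraph V) (c : Cycle V) : Prop :=
  c ≠ Cycle.nil ∧ c.Nodup ∧ c.Chain G.Adj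

/-- A collection of vertex-disjoint cycles of a digraph. -/
def IsDisjointCycleCollection (G : Digraph V) (C : Set (Cycle V)) : Prop :=
  (∀ c ∈ C, G.IsDirectedCycle c) ∧
    ∀ c ∈ C, ∀ c' ∈ C, c ≠ c' → ∀ x, x ∈ c → x ∉ c'

/-- The vertices covered by a collection of cycles. -/
def coveredVertices (C : Set (Cycle V)) : Set V := {x | ∃ c ∈ C, x ∈ c}

/-- `(x, y)` is an edge of the cycle `c`: `y` follows `x` in `c`. -/
def IsCycleEdge (c : Cycle V) (x y : V) : Prop :=
  ∃ (hc : c.Nodup) (hx : x ∈ c), c.next hc x hx = y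

/-- The digraph is a union of vertex-disjoint cycles and isolated vertices: its edges are exactly
the edges of some vertex-disjoint cycles of it, and a vertex on none of these cycles is incident
to no edge. -/
def IsUnionOfDisjointCyclesAndIsolated (G : Digraph V) : Prop :=
  ∃ C : Set (Cycle V), G.IsDisjointCycleCollection C ∧
    (∀ x y, G.Adj x y ↔ ∃ c ∈ C, IsCycleEdge c x y) ∧
    ∀ x, x ∉ coveredVertices C → ∀ y, ¬ G.Adj x y ∧ ¬ G.Adj y x

end Digraph

/-- A bipartite graph with left part `L` and right part `R`; edges are directed from `R` to `L`.
A common label in `L` and `R` denotes two different vertices. -/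
structure BipartiteDigraph (L R : Type) where
  /-- The edge set. -/
  edges : Set (R × L)

namespace BipartiteDigraph

variable {L R : Type}

/-- A set of edges no two of which share an end vertex. -/
def IsMatching (B : BipartiteDigraph L R) (M : Finset (R × L)) : Prop :=
  (∀ e ∈ M, e ∈ B.edges) ∧
    ∀ e ∈ M, ∀ f ∈ M, e ≠ f → e.1 ≠ f.1 ∧ e.2 ≠ f.2

/-- A matching of the largest size among all matchings. -/
def IsMaximumMatching (B : BipartiteDigraph L R) (M : Finset (R × L)) : Prop :=
  B.IsMatching M ∧ ∀ M' : Finset (R × L), B.IsMatching M' → M'.card ≤ M.card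

end BipartiteDigraph

namespace StructuredMatrix

variable {n : ℕ}

/-- The digraph of a square structured matrix: an edge `x_i → x_j` when the `(j, i)` entry
is `*`. -/
def digraph (A : StructuredMatrix n n) : Digraph (Fin n) where
  Adj i j := A j i = StructEntry.star

/-- The bipartite graph of a structured matrix: the left part consists of the rows, the right part
of the columns, and column `i` is joined to row `j` when the `(j, i)` entry is `*`. -/
def bipartite {n₁ n₂ : ℕ} (M : StructuredMatrix n₁ n₂) : BipartiteDigraph (Fin n₁) (Fin n₂) where
  edges := {e | M e.2 e.1 = StructEntry.star}

/-- `v(A)`: the maximum number of vertices covered by a collection of vertex-disjoint cycles. -/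
noncomputable def maxCycleCover (A : StructuredMatrix n n) : ℕ :=
  sSup {k | ∃ C : Set (Cycle (Fin n)),
    A.digraph.IsDisjointCycleCollection C ∧ (Digraph.coveredVertices C).ncard = k}

/-- The supremum in the definition of `v(A)` is a maximum. -/
theorem isGreatest_maxCycleCover (A : StructuredMatrix n n) :
    IsGreatest {k | ∃ C : Set (Cycle (Fin n)),
      A.digraph.IsDisjointCycleCollection C ∧ (Digraph.coveredVertices C).ncard = k}
      (maxCycleCover A) := by
  have hne : {k | ∃ C : Set (Cycle (Fin n)),
      A.digraph.IsDisjointCycleCollection C ∧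
        (Digraph.coveredVertices C).ncard = k}.Nonempty :=
    ⟨_, ∅, ⟨fun _ h => h.elim, fun _ h => h.elim⟩, rfl⟩
  have hb : BddAbove {k | ∃ C : Set (Cycle (Fin n)),
      A.digraph.IsDisjointCycleCollection C ∧
        (Digraph.coveredVertices C).ncard = k} := by
    refine ⟨n, ?_⟩
    rintro _ ⟨C, -, rfl⟩
    simpa using Set.ncard_le_card (Digraph.coveredVertices C)
  exact ⟨Nat.sSup_mem hne hb, fun _ hk => le_csSup hb hk⟩

end StructuredMatrix

/-- The digraph `(X, ℳ)` with vertex set `X = Fin n` and edge set `ℳ`. -/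
def edgeSetDigraph {n : ℕ} (M : Finset (Fin n × Fin n)) : Digraph (Fin n) where
  Adj i j := (i, j) ∈ M

/-! Matchings give the generic rank: a nonzero Leibniz term of a minor is a matching, and ones
placed on a matching give an identity submatrix. A disjoint cycle family is a matching that permutes
the vertices it covers. Hence v ≤ grank always, and equality holds exactly when some maximum
matching consists of cycles; this is (b) ⇔ (c).

(a) ⇒ (b): in the Leibniz expansion of the characteristic polynomial, the nonzero entries used by a
surviving term form disjoint cycles and all other factors are X, so X ^ (n - v) divides it
(`X_pow_dvd_charpoly_realization`). For a diagonalizable matrix the multiplicity of the root 0 is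
the nullity, so the rank is at most v. Some realization off the variety attains rank grank.

(b) ⇒ (a): let r = grank. A matrix of rank at most r with r distinct nonzero eigenvalues is
diagonalizable, since their eigenvectors and the kernel span (`exists_diagonalization`). Such
eigenvalues exist once det (tr A ^ (i + j + 1)), for i, j < r, is nonzero
(`exists_eigenvalues_of_det_traceHankel_ne_zero`). This is a polynomial in the parameters. It does
not vanish identically: distinct weights on the cycles of a largest family give v = r distinct
eigenvalues, each a weight times a root of unity. -/

namespace Cycle

/-! ### Cycles described by their successor map. -/

variable {α : Type*} [DecidableEq α]

theorem chain_iff_forall_next {r : α → α → Prop} {c : Cycle α} (hc : c.Nodup) :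
    c.Chain r ↔ ∀ x (hx : x ∈ c), r x (c.next hc x hx) := by
  induction c using Quotient.inductionOn' with
  | h l =>
    have key : ∀ (x : α) (hx : x ∈ l), Cycle.next (l : Cycle α) hc x hx = l.next x hx :=
      fun _ _ => rfl
    change Cycle.Chain r (l : Cycle α) ↔ ∀ x (hx : x ∈ l), r x (l.next x hx)
    have hl : l.Nodup := hc
    cases l with
    | nil => simp
    | cons a l =>
      rw [Cycle.chain_coe_cons, List.isChain_iff_getElem]
      constructor
      · intro h x hx
        obtain ⟨i, hi, rfl⟩ := List.getElem_of_mem hx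
        rw [List.next_getElem _ hl]
        have := h i (by simp at hi ⊢; omega)
        simp only [List.length_cons] at hi
        -- The last entry wraps around to the head, where the index modulo the length is 0.
        rcases Nat.lt_or_ge (i + 1) (l.length + 1) with h1 | h1
        · simp only [List.length_cons, Nat.mod_eq_of_lt h1]
          grind
        · have : i = l.length := by omega
          subst this
          simp only [List.length_cons, Nat.mod_self]
          grind
      · intro h i hi
        have hi' : i < (a :: l).length := by simp at hi ⊢; omega
        have := h _ (List.getElem_mem hi')
        rw [List.next_getElem _ hl] at this
        simp only [List.length_cons] at hi'
        rcases Nat.lt_or_ge (i + 1) (l.length + 1) with h1 | h1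
        · simp only [List.length_cons, Nat.mod_eq_of_lt h1] at this
          grind
        · have : i = l.length := by omega
          subst this
          simp only [List.length_cons, Nat.mod_self] at this
          grind

end Cycle

/-! ### Disjoint cycle collections as permutations. -/

namespace Digraph

section

variable {V : Type} [DecidableEq V] {G : Digraph V} {C : Set (Cycle V)}

theorem IsDisjointCycleCollection.eq_of_mem (hC : G.IsDisjointCycleCollection C) {c c' : Cycle V}
    (hc : c ∈ C) (hc' : c' ∈ C) {x : V} (hx : x ∈ c) (hx' : x ∈ c') : c = c' := by
  by_contra h
  exact hC.2 c hc c' hc' h x hx hx'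

theorem IsDisjointCycleCollection.adj_of_isCycleEdge (hC : G.IsDisjointCycleCollection C)
    {c : Cycle V} (hc : c ∈ C) {x y : V} (h : IsCycleEdge c x y) : G.Adj x y := by
  obtain ⟨hn, hx, rfl⟩ := h
  exact (Cycle.chain_iff_forall_next hn).1 (hC.1 c hc).2.2 x hx

/-- The successor map of a collection of disjoint cycles, extended by the identity. -/
theorem IsDisjointCycleCollection.exists_perm [Finite V] (hC : G.IsDisjointCycleCollection C) :
    ∃ σ : Equiv.Perm V, (∀ x ∉ coveredVertices C, σ x = x) ∧
      ∀ x y, (∃ c ∈ C, IsCycleEdge c x y) ↔ x ∈ coveredVertices C ∧ σ x = y := by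
  classical
  have hnext : ∀ x ∈ coveredVertices C, ∃ y, ∃ c ∈ C, IsCycleEdge c x y := by
    rintro x ⟨c, hc, hx⟩
    exact ⟨_, c, hc, (hC.1 c hc).2.1, hx, rfl⟩
  have huniq : ∀ {x y z}, (∃ c ∈ C, IsCycleEdge c x y) → (∃ c ∈ C, IsCycleEdge c x z) → y = z := by
    rintro x y z ⟨c, hc, h1, hx, rfl⟩ ⟨c', hc', h1', hx', rfl⟩
    obtain rfl := hC.eq_of_mem hc hc' hx hx'
    rfl
  have hinj : ∀ {x y z}, (∃ c ∈ C, IsCycleEdge c x z) → (∃ c ∈ C, IsCycleEdge c y z) → x = y := by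
    rintro x y z ⟨c, hc, h1, hx, rfl⟩ ⟨c', hc', h1', hy, h⟩
    have hm := c.next_mem h1 x hx
    have hm' := c'.next_mem h1' y hy
    rw [h] at hm'
    obtain rfl := hC.eq_of_mem hc hc' hm hm'
    rw [← c.prev_next h1 x hx, ← c.prev_next h1 y hy]
    congr 1
    exact h.symm
  have hcov : ∀ {x y}, (∃ c ∈ C, IsCycleEdge c x y) → y ∈ coveredVertices C := by
    rintro x y ⟨c, hc, h1, hx, rfl⟩
    exact ⟨c, hc, c.next_mem h1 x hx⟩
  choose! f hf using hnext
  let g : V → V := fun x => if x ∈ coveredVertices C then f x else x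
  -- Successors of covered vertices are covered, so they never collide with the fixed uncovered
  -- ones.
  have hg : Function.Injective g := by
    intro x y hxy
    simp only [g] at hxy
    split_ifs at hxy with hx hy hy
    · exact hinj (hf x hx) (hxy ▸ hf y hy)
    · exact absurd (hxy ▸ hcov (hf x hx)) hy
    · exact absurd (hxy ▸ hcov (hf y hy)) hx
    · exact hxy
  refine ⟨Equiv.ofBijective g (Finite.injective_iff_bijective.1 hg), fun x hx => ?_,
    fun x y => ⟨fun h => ?_, ?_⟩⟩
  · simp [g, hx]
  · have hx : x ∈ coveredVertices C := by
      obtain ⟨c, hc, h1, hx, -⟩ := h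
      exact ⟨c, hc, hx⟩
    refine ⟨hx, ?_⟩
    simpa [g, hx] using huniq (hf x hx) h
  · rintro ⟨hx, rfl⟩
    simpa [g, hx] using hf x hx

end

/-- The orbits of a permutation inside an invariant set whose arrows are edges. -/
theorem exists_isDisjointCycleCollection {V : Type} [Finite V] {G : Digraph V} (σ : Equiv.Perm V) (S : Set V)
    (hS : ∀ x ∈ S, σ x ∈ S) (hadj : ∀ x ∈ S, G.Adj x (σ x)) :
    ∃ C : Set (Cycle V), G.IsDisjointCycleCollection C ∧ coveredVertices C = S := by
  have hper : ∀ x, x ∈ Function.periodicPts σ := fun x =>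
    Function.Injective.mem_periodicPts σ.injective x
  have hit : ∀ x ∈ S, ∀ k, σ^[k] x ∈ S := by
    intro x hx k
    induction k with
    | zero => exact hx
    | succ k ih => rw [Function.iterate_succ_apply']; exact hS _ ih
  refine ⟨Function.periodicOrbit σ '' S, ⟨?_, ?_⟩, ?_⟩
  · rintro _ ⟨x, hx, rfl⟩
    refine ⟨by simp [hper x], Function.nodup_periodicOrbit, ?_⟩
    rw [Function.periodicOrbit_chain' _ (hper x)]
    intro k
    rw [Function.iterate_succ_apply']
    exact hadj _ (hit x hx k)
  · rintro _ ⟨x, hx, rfl⟩ _ ⟨y, hy, rfl⟩ hne z hz hz'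
    rw [Function.mem_periodicOrbit_iff (hper _)] at hz hz'
    obtain ⟨i, rfl⟩ := hz
    obtain ⟨j, hj⟩ := hz'
    apply hne
    rw [← Function.periodicOrbit_apply_iterate_eq (hper x) i, ← hj,
      Function.periodicOrbit_apply_iterate_eq (hper y) j]
  · ext z
    constructor
    · rintro ⟨_, ⟨x, hx, rfl⟩, hz⟩
      rw [Function.mem_periodicOrbit_iff (hper _)] at hz
      obtain ⟨i, rfl⟩ := hz
      exact hit x hx i
    · intro hz
      exact ⟨_, ⟨z, hz, rfl⟩, Function.self_mem_periodicOrbit (hper z)⟩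

end Digraph

/-! ### Rank, diagonalization and the trace Hankel determinant. -/

namespace Matrix

/-- A matrix has an invertible square submatrix whose size is the rank. -/
theorem exists_submatrix_det_ne_zero {K m n : Type} [Field K] [Fintype m] [Fintype n]
    (A : Matrix m n K) :
    ∃ (e : Fin A.rank → m) (f : Fin A.rank → n), Function.Injective e ∧ Function.Injective f ∧
      (A.submatrix e f).det ≠ 0 := by
  obtain ⟨κ, a, ha, hspan, hli⟩ := exists_linearIndependent' K A.row
  have : Finite κ := Finite.of_injective a ha
  have : Fintype κ := Fintype.ofFinite κ
  have hκ : Fintype.card κ = A.rank := by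
    rw [rank_eq_finrank_span_row, ← hspan, finrank_span_eq_card hli]
  let B : Matrix κ n K := A.submatrix a id
  have hB : B.rank = A.rank := by
    rw [← hκ]
    exact LinearIndependent.rank_matrix (M := B) hli
  -- The columns are chosen inside the selected rows, which already carry the full rank.
  obtain ⟨κ', b, hb, hspan', hli'⟩ := exists_linearIndependent' K Bᵀ.row
  have : Finite κ' := Finite.of_injective b hb
  have : Fintype κ' := Fintype.ofFinite κ'
  have hκ' : Fintype.card κ' = A.rank := by
    rw [← hB, ← rank_transpose, rank_eq_finrank_span_row, ← hspan', finrank_span_eq_card hli']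
  let i : Fin A.rank ≃ κ := (Fintype.equivFinOfCardEq hκ).symm
  let j : Fin A.rank ≃ κ' := (Fintype.equivFinOfCardEq hκ').symm
  refine ⟨a ∘ i, b ∘ j, ha.comp i.injective, hb.comp j.injective, ?_⟩
  have h : LinearIndependent K (Bᵀ.submatrix (b ∘ j) i).row := by
    have h1 : LinearIndependent K (fun k => (Bᵀ.row ∘ b) (j k)) := hli'.comp j j.injective
    exact h1.map' (LinearMap.funLeft K K i)
      (LinearMap.ker_eq_bot.2 (LinearMap.funLeft_injective_of_surjective K K i i.surjective))
  rw [linearIndependent_rows_iff_isUnit, isUnit_iff_isUnit_det, ← det_transpose] at h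
  exact h.ne_zero

/-- A field extension does not change the rank. -/
theorem rank_map_ringHom {K L m n : Type} [Field K] [Field L] [Fintype m] [Fintype n]
    (A : Matrix m n K) (φ : K →+* L) : (A.map φ).rank = A.rank := by
  -- Rank is detected by nonvanishing minors, and a field homomorphism preserves and reflects these.
  have hdet : ∀ {r : ℕ} (e : Fin r → m) (f : Fin r → n),
      ((A.map φ).submatrix e f).det = φ (A.submatrix e f).det := by
    intro r e f
    rw [RingHom.map_det]
    rfl
  apply le_antisymm
  · obtain ⟨e, f, -, -, h⟩ := (A.map φ).exists_submatrix_det_ne_zero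
    rw [hdet, map_ne_zero] at h
    have := rank_submatrix_le A e f
    rwa [rank_of_det_ne_zero h, Fintype.card_fin] at this
  · obtain ⟨e, f, -, -, h⟩ := A.exists_submatrix_det_ne_zero
    rw [← map_ne_zero φ, ← hdet] at h
    have := rank_submatrix_le (A.map φ) e f
    rwa [rank_of_det_ne_zero h, Fintype.card_fin] at this

/-- A complex matrix of rank at most `r` with `r` distinct nonzero eigenvalues is diagonalizable,
and these are its nonzero eigenvalues. -/
theorem exists_diagonalization {n r : ℕ} (B : Matrix (Fin n) (Fin n) ℂ) (hr : B.rank ≤ r)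
    (μ : Fin r → ℂ) (hinj : Function.Injective μ) (h0 : ∀ i, μ i ≠ 0)
    (hμ : ∀ i, Module.End.HasEigenvalue (Matrix.toLin' B) (μ i)) :
    ∃ (P : Matrix (Fin n) (Fin n) ℂ) (d : Fin n → ℂ), IsUnit P ∧ B = P * diagonal d * P⁻¹ ∧
      ∀ k : ℕ, ∑ i, d i ^ (k + 1) = ∑ i, μ i ^ (k + 1) := by
  classical
  set T := Matrix.toLin' B with hT
  choose v hv using fun i => (hμ i).exists_hasEigenvector
  have hvli : LinearIndependent ℂ v := Module.End.eigenvectors_linearIndependent' T μ hinj v hv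
  let b := Module.finBasis ℂ (LinearMap.ker T)
  let w : Fin (Module.finrank ℂ (LinearMap.ker T)) → (Fin n → ℂ) := fun i => b i
  have hwli : LinearIndependent ℂ w := b.linearIndependent.map' (Submodule.subtype _) (by simp)
  have hdis : Disjoint (Submodule.span ℂ (Set.range v)) (Submodule.span ℂ (Set.range w)) := by
    refine ((Module.End.eigenspaces_iSupIndep T 0).symm).mono ?_ ?_
    · rw [Submodule.span_le]
      rintro _ ⟨i, rfl⟩
      exact Submodule.mem_iSup_of_mem (μ i) (Submodule.mem_iSup_of_mem (h0 i) (hv i).1)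
    · rw [Submodule.span_le]
      rintro _ ⟨i, rfl⟩
      rw [Module.End.eigenspace_zero]
      exact (b i).2
  have hli := hvli.sum_type hwli hdis
  have hrank : B.rank + Module.finrank ℂ (LinearMap.ker T) = n := by
    have := LinearMap.finrank_range_add_finrank_ker T
    rw [Module.finrank_fin_fun] at this
    exact this
  -- Independence gives r + nullity ≤ n; the rank bound `hr` gives the reverse inequality.
  have hcard : Fintype.card (Fin r ⊕ Fin (Module.finrank ℂ (LinearMap.ker T))) = n := by
    have := hli.fintype_card_le_finrank
    rw [Module.finrank_fin_fun] at this
    simp only [Fintype.card_sum, Fintype.card_fin] at this ⊢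
    omega
  let e : Fin n ≃ Fin r ⊕ Fin (Module.finrank ℂ (LinearMap.ker T)) :=
    (Fintype.equivFinOfCardEq hcard).symm
  let u : Fin n → Fin n → ℂ := fun i => Sum.elim v w (e i)
  let d : Fin n → ℂ := fun i => Sum.elim μ 0 (e i)
  have huli : LinearIndependent ℂ u := hli.comp e e.injective
  have hBu : ∀ i, B *ᵥ u i = d i • u i := by
    intro i
    simp only [u, d]
    rcases e i with j | j
    · exact (hv j).apply_eq_smul
    · have := LinearMap.mem_ker.1 (b j).2
      simpa only [hT, toLin'_apply, w, Sum.elim_inr, Pi.zero_apply, zero_smul] using this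
  let P : Matrix (Fin n) (Fin n) ℂ := (Matrix.of u)ᵀ
  have hP : IsUnit P := by
    have := (linearIndependent_rows_iff_isUnit (A := Matrix.of u)).1 huli
    rw [isUnit_iff_isUnit_det] at this ⊢
    rwa [det_transpose]
  have hBP : B * P = P * diagonal d := by
    ext i j
    rw [mul_diagonal]
    have := congrFun (hBu j) i
    simp only [Pi.smul_apply, smul_eq_mul] at this
    rw [mul_comm]
    exact this
  refine ⟨P, d, hP, ?_, fun k => ?_⟩
  · rw [← hBP, Matrix.mul_assoc, Matrix.mul_nonsing_inv _ ((isUnit_iff_isUnit_det P).1 hP),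
      Matrix.mul_one]
  -- The exponent is positive, so the zero eigenvalues contribute nothing.
  · rw [Fintype.sum_equiv e _ (fun s => (Sum.elim μ 0 s : ℂ) ^ (k + 1)) fun i => rfl]
    simp [Fintype.sum_sum_type]

/-- The Hankel matrix of the traces of the powers `A, A ^ 2, …`. -/
def traceHankel {R : Type*} [CommRing R] {n : ℕ} (r : ℕ) (A : Matrix (Fin n) (Fin n) R) :
    Matrix (Fin r) (Fin r) R :=
  of fun i j => trace (A ^ ((i : ℕ) + j + 1))

theorem traceHankel_map {R S : Type*} [CommRing R] [CommRing S] {n : ℕ} (r : ℕ)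
    (A : Matrix (Fin n) (Fin n) R) (φ : R →+* S) :
    traceHankel r (A.map φ) = (traceHankel r A).map φ := by
  ext i j
  have : (A.map φ) ^ ((i : ℕ) + j + 1) = (A ^ ((i : ℕ) + j + 1)).map φ :=
    (map_pow φ.mapMatrix A _).symm
  simp only [traceHankel, of_apply, map_apply, this]
  exact (AddMonoidHom.map_trace φ _).symm

theorem det_traceHankel_map {R S : Type*} [CommRing R] [CommRing S] {n : ℕ} (r : ℕ)
    (A : Matrix (Fin n) (Fin n) R) (φ : R →+* S) :
    (traceHankel r (A.map φ)).det = φ (traceHankel r A).det := by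
  rw [traceHankel_map, ← RingHom.mapMatrix_apply, RingHom.map_det]

/-- The traces are power sums of the μ i, so the Hankel matrix factors as Vᵀ D V with V Vandermonde
and D diagonal, both invertible. -/
theorem det_traceHankel_ne_zero {n r : ℕ} {B : Matrix (Fin n) (Fin n) ℂ} (hr : B.rank ≤ r)
    (μ : Fin r → ℂ) (hinj : Function.Injective μ) (h0 : ∀ i, μ i ≠ 0)
    (hμ : ∀ i, Module.End.HasEigenvalue (Matrix.toLin' B) (μ i)) :
    (traceHankel r B).det ≠ 0 := by
  obtain ⟨P, d, hP, hB, hd⟩ := exists_diagonalization B hr μ hinj h0 hμ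
  have hpow : ∀ k, trace (B ^ (k + 1)) = ∑ i, μ i ^ (k + 1) := by
    intro k
    obtain ⟨U, rfl⟩ := hP
    rw [← hd, hB, ← coe_units_inv, Units.conj_pow, trace_units_conj, diagonal_pow, trace_diagonal]
    rfl
  have : traceHankel r B = (vandermonde μ)ᵀ * (diagonal μ * vandermonde μ) := by
    ext i j
    rw [traceHankel, of_apply, hpow, mul_apply]
    simp only [transpose_apply, diagonal_mul, vandermonde_apply]
    refine Finset.sum_congr rfl fun k _ => ?_
    ring
  rw [this, det_mul, det_mul, det_transpose, det_diagonal]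
  have hv := det_vandermonde_ne_zero_iff.2 hinj
  exact mul_ne_zero hv (mul_ne_zero (Finset.prod_ne_zero_iff.2 fun i _ => h0 i) hv)

/-- With fewer than r distinct nonzero eigenvalues, let f be the monic polynomial having them as
simple roots. Then B f(B) is nilpotent, so every tr (B ^ i · B f(B)) vanishes, and the coefficients
of f form a kernel vector of the Hankel matrix. -/
theorem exists_eigenvalues_of_det_traceHankel_ne_zero {n r : ℕ} {B : Matrix (Fin n) (Fin n) ℂ}
    (h : (traceHankel r B).det ≠ 0) :
    ∃ μ : Fin r → ℂ, Function.Injective μ ∧ (∀ i, μ i ≠ 0) ∧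
      ∀ i, Module.End.HasEigenvalue (Matrix.toLin' B) (μ i) := by
  classical
  let s : Finset ℂ := B.charpoly.roots.toFinset.erase 0
  have hs : ∀ z ∈ s, z ≠ 0 ∧ Module.End.HasEigenvalue (Matrix.toLin' B) z := by
    intro z hz
    simp only [s, Finset.mem_erase, Multiset.mem_toFinset] at hz
    refine ⟨hz.1, ?_⟩
    rw [Module.End.hasEigenvalue_iff_isRoot_charpoly, charpoly_toLin']
    exact Polynomial.isRoot_of_mem_roots hz.2
  by_cases hcard : r ≤ s.card
  · obtain ⟨t, hts, ht⟩ := Finset.exists_subset_card_eq hcard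
    let e := (Fintype.equivFinOfCardEq (α := t) (by simpa using ht)).symm
    exact ⟨fun i => e i, Subtype.val_injective.comp e.injective,
      fun i => (hs _ (hts (e i).2)).1, fun i => (hs _ (hts (e i).2)).2⟩
  exfalso
  apply h
  let f : Polynomial ℂ := ∏ z ∈ s, (Polynomial.X - Polynomial.C z)
  have hfm : f.Monic := Polynomial.monic_prod_X_sub_C _ _
  have hfdeg : f.natDegree < r := by
    rw [Polynomial.natDegree_prod_of_monic _ _ fun z _ => Polynomial.monic_X_sub_C z]
    simpa using not_le.1 hcard
  have hdvd : B.charpoly ∣ (Polynomial.X * f) ^ n := by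
    have hsplit := IsAlgClosed.splits B.charpoly
    rw [hsplit.eq_prod_roots_of_monic B.charpoly_monic]
    have hn : B.charpoly.roots.card = n := by
      rw [← hsplit.natDegree_eq_card_roots, charpoly_natDegree_eq_dim, Fintype.card_fin]
    have : ∀ m : Multiset ℂ, (∀ z ∈ m, z = 0 ∨ z ∈ s) →
        (m.map fun z => Polynomial.X - Polynomial.C z).prod ∣ (Polynomial.X * f) ^ m.card := by
      intro m
      induction m using Multiset.induction_on with
      | empty => simp
      | cons z m ih =>
        intro hm
        rw [Multiset.map_cons, Multiset.prod_cons, Multiset.card_cons, pow_succ']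
        refine mul_dvd_mul ?_ (ih fun z hz => hm z (Multiset.mem_cons_of_mem hz))
        rcases hm z (Multiset.mem_cons_self z m) with rfl | hz
        · simp
        · exact Dvd.dvd.mul_left (Finset.dvd_prod_of_mem _ hz) _
    have := this B.charpoly.roots fun z hz => by
      by_cases hz0 : z = 0
      · exact Or.inl hz0
      · right
        simp only [s, Finset.mem_erase, Multiset.mem_toFinset]
        exact ⟨hz0, hz⟩
    rwa [hn] at this
  have hnil : IsNilpotent (Polynomial.aeval B (Polynomial.X * f)) := by
    refine ⟨n, ?_⟩
    rw [← map_pow]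
    obtain ⟨g, hg⟩ := hdvd
    rw [hg, map_mul, aeval_self_charpoly, zero_mul]
  rw [← exists_mulVec_eq_zero_iff]
  -- The degree of f is below r, so its leading coefficient 1 is among these entries.
  refine ⟨fun j => f.coeff j, fun h0 => ?_, ?_⟩
  · have := congrFun h0 ⟨f.natDegree, hfdeg⟩
    simp [hfm] at this
  · ext i
    have hnil' : IsNilpotent (B ^ (i : ℕ) * Polynomial.aeval B (Polynomial.X * f)) := by
      refine Commute.isNilpotent_mul_left ?_ hnil
      have : B ^ (i : ℕ) = Polynomial.aeval B (Polynomial.X ^ (i : ℕ) : Polynomial ℂ) := by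
        simp
      rw [this]
      exact (Commute.all (Polynomial.X ^ (i : ℕ)) (Polynomial.X * f)).map (Polynomial.aeval B)
    have htr := (isNilpotent_trace_of_isNilpotent hnil').eq_zero
    rw [Pi.zero_apply, ← htr, map_mul, Polynomial.aeval_X,
      Polynomial.aeval_eq_sum_range' hfdeg, Finset.mul_sum, Finset.mul_sum, trace_sum,
      mulVec, dotProduct, ← Fin.sum_univ_eq_sum_range
        (fun k => trace (B ^ (i : ℕ) * (B * f.coeff k • B ^ k))) r]
    refine Finset.sum_congr rfl fun j _ => ?_
    rw [Matrix.mul_smul, Matrix.mul_smul, trace_smul, smul_eq_mul, mul_comm, traceHankel, of_apply,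
      pow_succ, pow_add, Matrix.mul_assoc, (Commute.pow_self B j).eq]

end Matrix

/-! ### Generic rank, matchings and cycle covers; (b) ⇔ (c) and (a) ⇒ (b). -/

namespace StructuredMatrix

theorem realization_eq_zero {n₁ n₂ : ℕ} {M : StructuredMatrix n₁ n₂} {θ : M.ParamSpace}
    {i : Fin n₁} {j : Fin n₂} (h : M i j ≠ StructEntry.star) : M.realization θ i j = 0 := by
  simp [realization, h]

theorem rank_realization_le_grank {n₁ n₂ : ℕ} (M : StructuredMatrix n₁ n₂) (θ : M.ParamSpace) :
    (M.realization θ).rank ≤ M.grank :=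
  M.isGreatest_grank.2 ⟨θ, rfl⟩

open Classical in
/-- The realization whose parameters are the indeterminates. -/
noncomputable def genericRealization {n₁ n₂ : ℕ} (M : StructuredMatrix n₁ n₂) :
    Matrix (Fin n₁) (Fin n₂) (MvPolynomial M.FreeEntry ℝ) :=
  Matrix.of fun i j => if h : M i j = StructEntry.star then MvPolynomial.X ⟨(i, j), h⟩ else 0

theorem genericRealization_map_eval {n₁ n₂ : ℕ} (M : StructuredMatrix n₁ n₂) (θ : M.ParamSpace) :
    M.genericRealization.map (MvPolynomial.eval θ) = M.realization θ := by
  ext i j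
  by_cases h : M i j = StructEntry.star <;> simp [genericRealization, realization, h]

theorem card_le_grank_of_isMatching {n₁ n₂ : ℕ} (A : StructuredMatrix n₁ n₂)
    {M : Finset (Fin n₂ × Fin n₁)} (hM : A.bipartite.IsMatching M) : M.card ≤ A.grank := by
  classical
  let θ : A.ParamSpace := fun p => if (p.1.2, p.1.1) ∈ M then 1 else 0
  -- An off-diagonal one would be a matching edge sharing an end with both e and f.
  have hsub : (A.realization θ).submatrix (fun e : M => e.1.2) (fun e : M => e.1.1) = 1 := by
    ext e f
    rw [Matrix.submatrix_apply, Matrix.one_apply]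
    by_cases hef : e = f
    · subst hef
      have h : A e.1.2 e.1.1 = StructEntry.star := hM.1 e.1 e.2
      simp [realization, h, θ]
    · rw [if_neg hef]
      by_cases h : A e.1.2 f.1.1 = StructEntry.star
      · have hnot : (f.1.1, e.1.2) ∉ M := by
          intro hmem
          have h1 : (f.1.1, e.1.2) = e.1 := by
            by_contra hne
            exact (hM.2 _ hmem _ e.2 hne).2 rfl
          have h2 : (f.1.1, e.1.2) = f.1 := by
            by_contra hne
            exact (hM.2 _ hmem _ f.2 hne).1 rfl
          exact hef (Subtype.ext (h1.symm.trans h2))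
        simp [realization, h, θ, hnot]
      · exact realization_eq_zero h
  have h := Matrix.rank_submatrix_le (A.realization θ) (fun e : M => e.1.2) (fun e : M => e.1.1)
  rw [hsub, Matrix.rank_one, Fintype.card_coe] at h
  exact h.trans (A.rank_realization_le_grank θ)

/-- A nonzero minor of size grank has a nonzero Leibniz term, whose entries are the matching. -/
theorem exists_isMatching_card_eq_grank {n₁ n₂ : ℕ} (A : StructuredMatrix n₁ n₂) :
    ∃ M : Finset (Fin n₂ × Fin n₁), A.bipartite.IsMatching M ∧ M.card = A.grank := by
  classical
  obtain ⟨θ, hθ⟩ := A.isGreatest_grank.1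
  obtain ⟨e, f, he, hf, hdet⟩ := (A.realization θ).exists_submatrix_det_ne_zero
  rw [Matrix.det_apply] at hdet
  obtain ⟨σ, -, hσ⟩ := Finset.exists_ne_zero_of_sum_ne_zero hdet
  have hprod := Finset.prod_ne_zero_iff.1 (right_ne_zero_of_smul hσ)
  refine ⟨Finset.univ.image fun i => (f i, e (σ i)), ⟨?_, ?_⟩, ?_⟩
  · intro p hp
    obtain ⟨i, -, rfl⟩ := Finset.mem_image.1 hp
    by_contra h
    exact hprod i (Finset.mem_univ i) (realization_eq_zero h)
  · intro p hp q hq hpq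
    obtain ⟨i, -, rfl⟩ := Finset.mem_image.1 hp
    obtain ⟨j, -, rfl⟩ := Finset.mem_image.1 hq
    have hij : i ≠ j := fun h => hpq (by rw [h])
    exact ⟨hf.ne hij, he.ne (σ.injective.ne hij)⟩
  · rw [Finset.card_image_of_injective _ fun i j h => hf (congrArg Prod.fst h), Finset.card_univ,
      Fintype.card_fin]
    exact hθ

variable {n : ℕ} (A : StructuredMatrix n n)

theorem card_le_maxCycleCover (σ : Equiv.Perm (Fin n)) (S : Finset (Fin n))
    (hS : ∀ x ∈ S, σ x ∈ S) (hadj : ∀ x ∈ S, A (σ x) x = StructEntry.star) :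
    S.card ≤ A.maxCycleCover := by
  obtain ⟨C, hC, hcov⟩ := Digraph.exists_isDisjointCycleCollection (G := A.digraph) σ (S : Set _)
    hS hadj
  exact A.isGreatest_maxCycleCover.2 ⟨C, hC, by rw [hcov, Set.ncard_coe_finset]⟩

/-- A largest family of disjoint cycles, as a permutation fixing all uncovered vertices. -/
theorem exists_isDisjointCycleCollection_perm :
    ∃ (C : Set (Cycle (Fin n))) (σ : Equiv.Perm (Fin n)) (S : Finset (Fin n)),
      A.digraph.IsDisjointCycleCollection C ∧ (∀ x, x ∈ S ↔ x ∈ Digraph.coveredVertices C) ∧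
      S.card = A.maxCycleCover ∧ (∀ x, σ x ∈ S ↔ x ∈ S) ∧
      (∀ x ∈ S, A (σ x) x = StructEntry.star) ∧
      ∀ x y, (∃ c ∈ C, Digraph.IsCycleEdge c x y) ↔ x ∈ S ∧ σ x = y := by
  classical
  obtain ⟨C, hC, hcard⟩ := A.isGreatest_maxCycleCover.1
  obtain ⟨σ, hσ, hedge⟩ := hC.exists_perm
  refine ⟨C, σ, (Digraph.coveredVertices C).toFinset, hC, by simp, ?_, fun x => ?_, fun x hx => ?_,
    by simpa using hedge⟩
  · rw [← hcard, Set.ncard_eq_toFinset_card']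
  · rw [Set.mem_toFinset, Set.mem_toFinset]
    constructor
    · intro h
      by_contra hx
      rw [hσ x hx] at h
      exact hx h
    · intro h
      by_contra hx
      have := σ.injective (hσ _ hx)
      rw [this] at hx
      exact hx h
  · rw [Set.mem_toFinset] at hx
    obtain ⟨c, hc, hce⟩ := (hedge x (σ x)).2 ⟨hx, rfl⟩
    exact hC.adj_of_isCycleEdge hc hce

theorem isMatching_image_perm (σ : Equiv.Perm (Fin n)) (S : Finset (Fin n))
    (hadj : ∀ x ∈ S, A (σ x) x = StructEntry.star) :
    A.bipartite.IsMatching (S.image fun x => (x, σ x)) := by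
  refine ⟨fun p hp => ?_, fun p hp q hq hpq => ?_⟩
  · obtain ⟨x, hx, rfl⟩ := Finset.mem_image.1 hp
    exact hadj x hx
  · obtain ⟨x, hx, rfl⟩ := Finset.mem_image.1 hp
    obtain ⟨y, hy, rfl⟩ := Finset.mem_image.1 hq
    have hxy : x ≠ y := fun h => hpq (by rw [h])
    exact ⟨hxy, σ.injective.ne hxy⟩

theorem card_image_perm {σ : Equiv.Perm (Fin n)} {S : Finset (Fin n)} :
    (S.image fun x => (x, σ x)).card = S.card :=
  Finset.card_image_of_injective _ fun _ _ h => congrArg Prod.fst h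

theorem maxCycleCover_le_grank : A.maxCycleCover ≤ A.grank := by
  obtain ⟨C, σ, S, -, -, hcard, -, hadj, -⟩ := A.exists_isDisjointCycleCollection_perm
  rw [← hcard, ← card_image_perm (σ := σ)]
  exact A.card_le_grank_of_isMatching (A.isMatching_image_perm σ S hadj)

/-- The edges of a largest cycle family form a matching of size v = grank, which no matching
exceeds. -/
theorem exists_cyclic_maximum_matching (h : A.grank = A.maxCycleCover) :
    ∃ M : Finset (Fin n × Fin n), A.bipartite.IsMaximumMatching M ∧
      (edgeSetDigraph M).IsUnionOfDisjointCyclesAndIsolated := by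
  obtain ⟨C, σ, S, hC, hS, hcard, hσS, hadj, hedge⟩ := A.exists_isDisjointCycleCollection_perm
  have hmem : ∀ x y, (x, y) ∈ S.image (fun x => (x, σ x)) ↔ x ∈ S ∧ σ x = y := by
    intro x y
    simp only [Finset.mem_image, Prod.mk.injEq]
    constructor
    · rintro ⟨z, hz, rfl, rfl⟩
      exact ⟨hz, rfl⟩
    · rintro ⟨hx, rfl⟩
      exact ⟨x, hx, rfl, rfl⟩
  refine ⟨S.image fun x => (x, σ x), ⟨A.isMatching_image_perm σ S hadj, fun M' hM' => ?_⟩,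
    C, ⟨fun c hc => ?_, hC.2⟩, fun x y => (hmem x y).trans (hedge x y).symm, fun x hx y => ?_⟩
  · rw [card_image_perm, hcard, ← h]
    exact A.card_le_grank_of_isMatching hM'
  · obtain ⟨h1, h2, h3⟩ := hC.1 c hc
    refine ⟨h1, h2, (Cycle.chain_iff_forall_next h2).2 fun x hx => ?_⟩
    exact (hmem _ _).2 ((hedge _ _).1 ⟨c, hc, h2, hx, rfl⟩)
  · rw [← hS] at hx
    refine ⟨fun h1 => hx ((hmem _ _).1 h1).1, fun h1 => ?_⟩
    obtain ⟨hy, rfl⟩ := (hmem _ _).1 h1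
    exact hx ((hσS y).2 hy)

theorem grank_eq_maxCycleCover_of_cyclic_maximum_matching
    (h : ∃ M : Finset (Fin n × Fin n), A.bipartite.IsMaximumMatching M ∧
      (edgeSetDigraph M).IsUnionOfDisjointCyclesAndIsolated) : A.grank = A.maxCycleCover := by
  refine le_antisymm ?_ A.maxCycleCover_le_grank
  obtain ⟨M, ⟨hM, hmax⟩, C, hC, hedge, -⟩ := h
  obtain ⟨M', hM', hcard⟩ := A.exists_isMatching_card_eq_grank
  obtain ⟨σ, -, hσ⟩ := hC.exists_perm
  have hCA : A.digraph.IsDisjointCycleCollection C :=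
    ⟨fun c hc => ⟨(hC.1 c hc).1, (hC.1 c hc).2.1,
      Cycle.Chain.imp (fun a b hab => hM.1 (a, b) hab) (hC.1 c hc).2.2⟩, hC.2⟩
  rw [← hcard]
  refine (hmax M' hM').trans (le_trans ?_ (A.isGreatest_maxCycleCover.2 ⟨C, hCA, rfl⟩))
  rw [← Set.ncard_coe_finset]
  -- Each matching edge is a cycle edge, hence determined by its covered source.
  refine Set.ncard_le_ncard_of_injOn Prod.fst ?_ ?_ (Set.toFinite _)
  · rintro ⟨x, y⟩ hxy
    exact ((hσ x y).1 ((hedge x y).1 hxy)).1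
  · rintro ⟨x, y⟩ hxy ⟨x', y'⟩ hxy' (rfl : x = x')
    have h1 := ((hσ x y).1 ((hedge x y).1 hxy)).2
    have h2 := ((hσ x y').1 ((hedge x y').1 hxy')).2
    rw [← h1, ← h2]

-- The bound is proved for each Leibniz term separately: a nonzero term has a factor X at every
-- fixed point with zero diagonal entry, and the remaining indices form disjoint cycles, at most v
-- in number.
open Polynomial in
theorem X_pow_dvd_charpoly_realization (θ : A.ParamSpace) :
    (X : ℝ[X]) ^ (n - A.maxCycleCover) ∣ (A.realization θ).charpoly := by
  classical
  set B := A.realization θ with hB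
  rw [Matrix.charpoly, Matrix.det_apply]
  refine Finset.dvd_sum fun σ _ => ?_
  rw [Units.smul_def, zsmul_eq_mul]
  refine Dvd.dvd.mul_left ?_ _
  by_cases h0 : ∏ i, B.charmatrix (σ i) i = 0
  · rw [h0]; exact dvd_zero _
  have hne := fun i => Finset.prod_ne_zero_iff.1 h0 i (Finset.mem_univ i)
  let S : Finset (Fin n) := Finset.univ.filter fun i => B (σ i) i ≠ 0
  have hfix : ∀ i, i ∉ S → σ i = i ∧ B.charmatrix (σ i) i = X := by
    intro i hi
    have hz : B (σ i) i = 0 := by simpa [S] using hi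
    have hσ : σ i = i := by
      by_contra h
      apply hne i
      rw [Matrix.charmatrix_apply_ne _ _ _ h, hz, C_0, neg_zero]
    refine ⟨hσ, ?_⟩
    rw [hσ] at hz ⊢
    rw [Matrix.charmatrix_apply_eq, hz, C_0, sub_zero]
  have hcard : S.card ≤ A.maxCycleCover := by
    refine A.card_le_maxCycleCover σ S (fun x hx => ?_) (fun x hx => ?_)
    · by_contra h
      have := σ.injective (hfix _ h).1
      rw [this] at h
      exact h hx
    · by_contra h
      exact (Finset.mem_filter.1 hx).2 (realization_eq_zero h)
  refine (pow_dvd_pow X (?_ : n - A.maxCycleCover ≤ Sᶜ.card)).trans ?_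
  · rw [Finset.card_compl, Fintype.card_fin]
    omega
  · rw [← Finset.prod_const, ← Finset.prod_congr rfl fun i hi => (hfix i (by simpa using hi)).2]
    exact Finset.prod_dvd_prod_of_subset _ _ _ (Finset.subset_univ _)

-- Diagonalizability makes the multiplicity of the eigenvalue 0 equal to the nullity; by the
-- divisibility above it is at least n - v.
open Polynomial in
theorem rank_le_maxCycleCover_of_diagonalizable (θ : A.ParamSpace)
    (h : IsDiagonalizableOverComplex (A.realization θ)) :
    (A.realization θ).rank ≤ A.maxCycleCover := by
  classical
  obtain ⟨P, d, hP, hA⟩ := h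
  have hrank : (A.realization θ).rank = Fintype.card {i // d i ≠ 0} := by
    have h1 : ((A.realization θ).map Complex.ofReal).rank = (A.realization θ).rank :=
      Matrix.rank_map_ringHom _ Complex.ofRealHom
    rw [← h1, hA, Matrix.rank_mul_eq_left_of_isUnit_det, Matrix.rank_mul_eq_right_of_isUnit_det,
      Matrix.rank_diagonal]
    · exact (Matrix.isUnit_iff_isUnit_det P).1 hP
    · rw [Matrix.isUnit_nonsing_inv_det_iff]
      exact (Matrix.isUnit_iff_isUnit_det P).1 hP
  have hchar : (A.realization θ).charpoly.map Complex.ofRealHom = ∏ i, (X - C (d i)) := by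
    rw [← Matrix.charpoly_map]
    change ((A.realization θ).map Complex.ofReal).charpoly = _
    obtain ⟨U, rfl⟩ := hP
    rw [hA, Matrix.charpoly_units_conj, Matrix.charpoly_diagonal]
  have hdvd := Polynomial.map_dvd Complex.ofRealHom (A.X_pow_dvd_charpoly_realization θ)
  rw [hchar, Polynomial.map_pow, map_X] at hdvd
  have hroots : (∏ i, (X - C (d i))).roots = Finset.univ.val.map d := by
    rw [← Polynomial.roots_multiset_prod_X_sub_C (Finset.univ.val.map d), Multiset.map_map]
    rfl
  have hmul : n - A.maxCycleCover ≤ (∏ i, (X - C (d i))).rootMultiplicity 0 := by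
    rw [Polynomial.le_rootMultiplicity_iff (Polynomial.monic_prod_X_sub_C _ _).ne_zero]
    simpa using hdvd
  rw [← Polynomial.count_roots, hroots, Multiset.count_map] at hmul
  have hfil : (Multiset.filter (fun a => 0 = d a) (Finset.univ : Finset (Fin n)).val).card
      = (Finset.univ.filter fun i => d i = 0).card := by
    simp only [eq_comm]
    rfl
  rw [hfil] at hmul
  have htot := Finset.card_filter_add_card_filter_not (s := (Finset.univ : Finset (Fin n)))
    (fun i => d i = 0)
  rw [Finset.card_univ, Fintype.card_fin] at htot
  rw [hrank, Fintype.card_subtype]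
  simp only [ne_eq]
  omega

theorem grank_eq_maxCycleCover_of_genericallyDiagonalizable (h : A.GenericallyDiagonalizable) :
    A.grank = A.maxCycleCover := by
  refine le_antisymm ?_ A.maxCycleCover_le_grank
  obtain ⟨V, ⟨⟨T, hT⟩, hV⟩, hdiag⟩ := h
  obtain ⟨θ₀, hθ₀⟩ := (Set.ne_univ_iff_exists_notMem V).1 hV
  have hp : ∃ p ∈ T, MvPolynomial.eval θ₀ p ≠ 0 := by
    simpa [hT] using hθ₀
  obtain ⟨p, hpT, hp⟩ := hp
  obtain ⟨θ₁, hθ₁⟩ := A.isGreatest_grank.1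
  obtain ⟨e, f, -, -, hdet⟩ := (A.realization θ₁).exists_submatrix_det_ne_zero
  have heval : ∀ θ, MvPolynomial.eval θ (A.genericRealization.submatrix e f).det
      = ((A.realization θ).submatrix e f).det := by
    intro θ
    rw [RingHom.map_det, RingHom.mapMatrix_apply, ← Matrix.submatrix_map,
      genericRealization_map_eval]
  -- The two factors are nonzero at possibly different points; their product is a nonzero
  -- polynomial, so both are nonzero at a common real point.
  have hpq : p * (A.genericRealization.submatrix e f).det ≠ 0 := by
    refine mul_ne_zero (fun h => hp (by rw [h, map_zero])) fun h => hdet ?_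
    rw [← heval, h, map_zero]
  obtain ⟨θ, hθ⟩ : ∃ θ, MvPolynomial.eval θ (p * (A.genericRealization.submatrix e f).det) ≠ 0 := by
    by_contra! hall
    exact hpq (MvPolynomial.funext fun θ => by rw [hall, map_zero])
  rw [map_mul, heval] at hθ
  have hθV : θ ∉ V := by
    rw [hT]
    exact fun hmem => left_ne_zero_of_mul hθ (hmem p hpT)
  have hr := Matrix.rank_submatrix_le (A.realization θ) e f
  rw [Matrix.rank_of_det_ne_zero (right_ne_zero_of_mul hθ), Fintype.card_fin] at hr
  rw [← hθ₁]
  exact hr.trans (A.rank_le_maxCycleCover_of_diagonalizable θ (hdiag θ hθV))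

end StructuredMatrix

/-! ### Eigenvalues of weighted permutations. -/

namespace Matrix

/-- A matrix acting as a weighted permutation, with a constant weight on a cycle of length `k`
through `c`, has `w * ζ` as an eigenvalue for every `k`-th root of unity `ζ`. -/
theorem hasEigenvalue_of_weighted_cycle {n : ℕ} {B : Matrix (Fin n) (Fin n) ℂ}
    {σ : Equiv.Perm (Fin n)} {c : Fin n} {w ζ : ℂ}
    (hB : ∀ j, B *ᵥ Pi.single (σ^[j] c) 1 = w • Pi.single (σ^[j + 1] c) 1)
    (hζ : ζ ^ Function.minimalPeriod σ c = 1) :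
    Module.End.HasEigenvalue (Matrix.toLin' B) (w * ζ) := by
  set k := Function.minimalPeriod σ c
  have hkpos : 0 < k :=
    Function.minimalPeriod_pos_of_mem_periodicPts (σ.injective.mem_periodicPts c)
  have hζ0 : ζ ≠ 0 := by
    rintro rfl
    rw [zero_pow hkpos.ne'] at hζ
    exact zero_ne_one hζ
  let e : ℕ → Fin n → ℂ := fun j => Pi.single (σ^[j] c) 1
  -- A discrete Fourier mode on the cycle: shifting the index multiplies it by ζ.
  let v : Fin n → ℂ := ∑ j ∈ Finset.range k, ζ⁻¹ ^ j • e j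
  have hshift : v = ∑ j ∈ Finset.range k, ζ⁻¹ ^ (j + 1) • e (j + 1) := by
    have h1 := Finset.sum_range_succ (fun j => ζ⁻¹ ^ j • e j) k
    rw [Finset.sum_range_succ'] at h1
    have h2 : ζ⁻¹ ^ k • e k = ζ⁻¹ ^ 0 • e 0 := by
      have h3 : σ^[k] c = c := Function.iterate_minimalPeriod
      simp only [e, h3, inv_pow, hζ, inv_one, pow_zero, Function.iterate_zero, id]
    rw [h2] at h1
    exact (add_right_cancel h1).symm
  refine Module.End.hasEigenvalue_of_hasEigenvector (x := v) ⟨?_, ?_⟩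
  · rw [Module.End.mem_eigenspace_iff, toLin'_apply]
    conv_rhs => rw [hshift]
    simp only [v]
    rw [mulVec_sum, Finset.smul_sum]
    refine Finset.sum_congr rfl fun j _ => ?_
    rw [mulVec_smul, hB j, smul_smul, smul_smul]
    rw [pow_succ, mul_comm (ζ⁻¹ ^ j) w, mul_assoc, mul_left_comm ζ, mul_inv_cancel₀ hζ0, mul_one]
  · intro hv
    have hc := congrFun hv c
    simp only [v, Finset.sum_apply, Pi.smul_apply, smul_eq_mul, Pi.zero_apply] at hc
    rw [Finset.sum_eq_single 0] at hc
    · simp [e] at hc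
    · intro j hj hj0
      have hne : c ≠ σ^[j] c := fun h =>
        absurd (Function.IsPeriodicPt.minimalPeriod_le (Nat.pos_of_ne_zero hj0) h.symm)
          (not_le.2 (Finset.mem_range.1 hj))
      simp [e, Pi.single_eq_of_ne hne]
    · intro h
      exact absurd (Finset.mem_range.2 hkpos) h

/-- If the cycles of a permutation carry distinct positive weights, a matrix acting as the weighted
permutation on a set of basis vectors has as many distinct nonzero eigenvalues as vectors. -/
theorem exists_eigenvalues_of_weighted_perm {n : ℕ} (σ : Equiv.Perm (Fin n)) :
    ∃ w : Fin n → ℝ, ∀ (S : Finset (Fin n)) (B : Matrix (Fin n) (Fin n) ℂ),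
      (∀ x, σ x ∈ S ↔ x ∈ S) →
      (∀ x ∈ S, B *ᵥ Pi.single x 1 = (w x : ℂ) • Pi.single (σ x) 1) →
      ∃ μ : S → ℂ, Function.Injective μ ∧ (∀ x, μ x ≠ 0) ∧
        ∀ x, Module.End.HasEigenvalue (Matrix.toLin' B) (μ x) := by
  let rep : Fin n → Fin n := fun x => (Quotient.mk (Equiv.Perm.SameCycle.setoid σ) x).out
  have hrep : ∀ x, σ.SameCycle (rep x) x := fun x =>
    Quotient.exact (s := Equiv.Perm.SameCycle.setoid σ) (Quotient.out_eq _)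
  have hrep_eq : ∀ {x y}, σ.SameCycle x y → rep x = rep y := fun h =>
    congrArg Quotient.out (Quotient.sound (s := Equiv.Perm.SameCycle.setoid σ) h)
  -- Constant on each cycle, distinct on distinct cycles; the + 1 keeps it positive.
  let w : Fin n → ℝ := fun x => (rep x : ℕ) + 1
  have hw : ∀ x, 0 < w x := fun x => by positivity
  have hw_inj : ∀ {x y}, w x = w y → rep x = rep y := by
    intro x y h
    simp only [w, add_left_inj, Nat.cast_inj] at h
    exact Fin.ext h
  let k : Fin n → ℕ := fun x => Function.minimalPeriod σ (rep x)
  have hk : ∀ x, 0 < k x := fun x =>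
    Function.minimalPeriod_pos_of_mem_periodicPts (σ.injective.mem_periodicPts _)
  have hpos : ∀ x, ∃ p < k x, σ^[p] (rep x) = x := by
    intro x
    obtain ⟨p, hp⟩ := (hrep x).exists_nat_pow_eq
    refine ⟨p % k x, Nat.mod_lt _ (hk x), ?_⟩
    rw [Function.iterate_mod_minimalPeriod_eq, ← Equiv.Perm.coe_pow]
    exact hp
  choose p hpk hp using hpos
  let ζ : Fin n → ℂ := fun x => Complex.exp (2 * Real.pi * Complex.I / k x)
  have hζ : ∀ x, IsPrimitiveRoot (ζ x) (k x) := fun x => Complex.isPrimitiveRoot_exp _ (hk x).ne'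
  have hnorm : ∀ x, ‖(w x : ℂ) * ζ x ^ p x‖ = w x := by
    intro x
    rw [norm_mul, norm_pow, (hζ x).norm'_eq_one (hk x).ne', one_pow, mul_one, Complex.norm_real,
      Real.norm_of_nonneg (hw x).le]
  -- The modulus of the eigenvalue recovers the cycle of x, and the power of ζ its position there.
  refine ⟨w, fun S B hS hB => ⟨fun x => w x * ζ x ^ p x, ?_, fun x h => ?_, fun x => ?_⟩⟩
  · intro x y hxy
    have hwxy : w x = w y := by
      have := congrArg norm hxy
      simpa only [hnorm] using this
    have hr := hw_inj hwxy
    have hkk : k x = k y := by simp only [k, hr]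
    have hζζ : ζ x = ζ y := by simp only [ζ, hkk]
    have hw0 : (w y : ℂ) ≠ 0 := by exact_mod_cast (hw y).ne'
    simp only [hwxy, hζζ] at hxy
    have hpp := (hζ y).pow_inj (hkk ▸ hpk x) (hpk y) (mul_left_cancel₀ hw0 hxy)
    apply Subtype.ext
    rw [← hp x, ← hp y, hpp, hr]
  · have := hnorm x
    beta_reduce at h
    rw [h, norm_zero] at this
    exact (hw x).ne this
  · have hit : ∀ c j, σ^[j] c ∈ S ↔ c ∈ S := by
      intro c j
      induction j with
      | zero => rfl
      | succ j ih => rw [Function.iterate_succ_apply', hS, ih]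
    have hc : rep x ∈ S := by
      rw [← hit _ (p x), hp]
      exact x.2
    refine hasEigenvalue_of_weighted_cycle (σ := σ) (c := rep x) (fun j => ?_) ?_
    · have hsame : σ.SameCycle (σ^[j] (rep x)) x := by
        rw [← Equiv.Perm.coe_pow]
        exact (Equiv.Perm.sameCycle_pow_left).2 (hrep x)
      have hwj : w (σ^[j] (rep x)) = w x := by simp only [w, hrep_eq hsame]
      rw [hB _ ((hit _ _).2 hc), hwj, Function.iterate_succ_apply']
    · change (ζ x ^ p x) ^ k x = 1
      rw [← pow_mul, mul_comm, pow_mul, (hζ x).pow_eq_one, one_pow]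

end Matrix

/-! ### The implication (b) ⇒ (a) and the equivalence. -/

namespace StructuredMatrix

variable {n : ℕ} (A : StructuredMatrix n n)

/-- If the generic rank equals the maximum cycle cover, a weighted union of disjoint cycles has
`A.grank` distinct nonzero eigenvalues. -/
theorem exists_realization_det_traceHankel_ne_zero (h : A.grank = A.maxCycleCover) :
    ∃ θ : A.ParamSpace,
      (Matrix.traceHankel A.grank ((A.realization θ).map Complex.ofRealHom)).det ≠ 0 := by
  classical
  obtain ⟨C, σ, S, -, -, hcard, hσS, hadj, -⟩ := A.exists_isDisjointCycleCollection_perm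
  obtain ⟨w, hw⟩ := Matrix.exists_eigenvalues_of_weighted_perm σ
  let θ : A.ParamSpace := fun q => if q.1.2 ∈ S ∧ q.1.1 = σ q.1.2 then w q.1.2 else 0
  obtain ⟨μ, hinj, h0, hμ⟩ := hw S ((A.realization θ).map Complex.ofRealHom) hσS fun x hx => by
    ext i
    rw [Matrix.mulVec_single_one, Matrix.col_apply, Matrix.map_apply, Pi.smul_apply,
      Pi.single_apply]
    by_cases hi : i = σ x
    · subst hi
      simp [realization, hadj x hx, θ, hx]
    · by_cases hs : A i x = StructEntry.star
      · simp [realization, hs, θ, hi]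
      · simp [realization_eq_zero hs, hi]
  let e : Fin A.grank ≃ S :=
    (Fintype.equivFinOfCardEq (by rw [Fintype.card_coe, hcard, h])).symm
  refine ⟨θ, Matrix.det_traceHankel_ne_zero ?_ (μ ∘ e) (hinj.comp e.injective)
    (fun i => h0 _) fun i => hμ _⟩
  rw [Matrix.rank_map_ringHom]
  exact A.rank_realization_le_grank θ

/-- The exceptional variety is the zero set of the Hankel determinant of the generic realization, a
real polynomial whose values are compared with complex determinants through `heval`. -/
theorem genericallyDiagonalizable_of_grank_eq_maxCycleCover (h : A.grank = A.maxCycleCover) :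
    A.GenericallyDiagonalizable := by
  have heval : ∀ θ : A.ParamSpace,
      (Matrix.traceHankel A.grank ((A.realization θ).map Complex.ofRealHom)).det
        = Complex.ofRealHom (MvPolynomial.eval θ
            (Matrix.traceHankel A.grank A.genericRealization).det) := by
    intro θ
    rw [Matrix.det_traceHankel_map, ← genericRealization_map_eval, Matrix.det_traceHankel_map]
  refine ⟨{θ | ∀ p ∈ {(Matrix.traceHankel A.grank A.genericRealization).det},
    MvPolynomial.eval θ p = 0}, ⟨⟨_, rfl⟩, ?_⟩, fun θ hθ => ?_⟩
  · obtain ⟨θ, hθ⟩ := A.exists_realization_det_traceHankel_ne_zero h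
    rw [heval, map_ne_zero] at hθ
    rw [Set.ne_univ_iff_exists_notMem]
    exact ⟨θ, fun hmem => hθ (hmem _ rfl)⟩
  · have hne : (Matrix.traceHankel A.grank
        ((A.realization θ).map Complex.ofRealHom)).det ≠ 0 := by
      rw [heval, map_ne_zero]
      simpa using hθ
    obtain ⟨μ, hinj, h0, hμ⟩ := Matrix.exists_eigenvalues_of_det_traceHankel_ne_zero hne
    have hr : ((A.realization θ).map Complex.ofRealHom).rank ≤ A.grank := by
      rw [Matrix.rank_map_ringHom]
      exact A.rank_realization_le_grank θ
    obtain ⟨P, d, hP, hB, -⟩ := Matrix.exists_diagonalization _ hr μ hinj h0 hμ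
    exact ⟨P, d, hP, hB⟩

end StructuredMatrix

theorem mainTheorem1 (n : ℕ) (A : StructuredMatrix n n) :
    List.TFAE [
      A.GenericallyDiagonalizable,
      A.grank = A.maxCycleCover,
      ∃ M : Finset (Fin n × Fin n), A.bipartite.IsMaximumMatching M ∧
        (edgeSetDigraph M).IsUnionOfDisjointCyclesAndIsolated] := by
  tfae_have 1 → 2 := A.grank_eq_maxCycleCover_of_genericallyDiagonalizable
  tfae_have 2 → 1 := A.genericallyDiagonalizable_of_grank_eq_maxCycleCover
  tfae_have 2 → 3 := A.exists_cyclic_maximum_matching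
  tfae_have 3 → 2 := A.grank_eq_maxCycleCover_of_cyclic_maximum_matching
  tfae_finish
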